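/- Let $\mathbb{D}^n=\{z\in\mathbb{R}^n:|z|<1\}$ carry the hyperbolic metric $d_H$ of the Poincaré ball model (length element $2|dz|/(1-|z|^2)$), and let $\Gamma$ be a Kleinian group, that is, a discrete group of orientation preserving isometries of $(\mathbb{D}^n,d_H)$. Its limit set is $L(\Gamma)=\overline{\Gamma(0)}\setminus\Gamma(0)$ (Euclidean closure), and its radial limit set is $$L_{rad}(\Gamma)=\{z\in\mathbb{R}^n:|z|=1,\ \exists c\ge 1\ \forall r>0\ \exists x\in\Gamma(0)\text{ such that }|z-x|\le c(1-|x|)\le cr\}.$$ Define $$\delta'(\Gamma)=\inf\Big\{s\ge 0:\sum_{g\in\Gamma}e^{-s\,d_H(0,g(0))}<\infty\Big\},\qquad \delta(\Gamma(0))=\inf\Big\{s\ge 0:\sum_{x\in\Gamma(0)}(1-|x|)^s<\infty\Big\},$$ with $\inf\emptyset=\infty$. For bounded $F\subseteq\mathbb{R}^n$ the upper box dimension is $\overline{\dim}_{\mathrm B}F=\limsup_{r\to0^+}\frac{\log N_r(F)}{-\log r}$, where $N_r(F)$ is the largest number of pairwise disjoint closed balls of radius $r$ with centres in $F$ (and $\overline{\dim}_{\mathrm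 B}\emptyset=0$); $\dim_{\mathrm H}$ denotes Hausdorff dimension. Call $\Gamma$ non-elementary if $L(\Gamma)$ has more than two points. If $\Gamma$ is a non-elementary Kleinian group, then $\delta'(\Gamma)=\delta(\Gamma(0))$ and, writing $\delta(\Gamma)$ for this common value (the Poincaré exponent), $$\dim_{\mathrm H}L_{rad}(\Gamma)\le\delta(\Gamma)\le\overline{\dim}_{\mathrm B}L(\Gamma).$$ -/

import Mathlib

open Set Filter Topology
open scoped ENNReal NNReal

noncomputable section

namespace HypBall

/-- Euclidean space `ℝⁿ`. -/
abbrev E (n : ℕ) : Type := EuclideanSpace ℝ (Fin n)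

/-- The open unit ball `𝔻ⁿ` of `ℝⁿ`. -/
abbrev Ball (n : ℕ) : Type := Metric.ball (0 : E n) 1

/-- The centre of the ball. -/
def origin (n : ℕ) : Ball n := ⟨0, by simp⟩

/-- The hyperbolic metric of the Poincaré ball model: the distance function of the length element
`2 |dz| / (1 - |z|²)` on the unit ball, in closed form. -/
def hdist {n : ℕ} (x y : Ball n) : ℝ :=
  2 * Real.arsinh (dist (x : E n) y / √((1 - ‖(x : E n)‖ ^ 2) * (1 - ‖(y : E n)‖ ^ 2)))

/-- The normalisation of `hdist`: the distance of `x` to the centre is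
`log ((1 + |x|) / (1 - |x|))`. -/
theorem exp_neg_hdist_origin {n : ℕ} (x : Ball n) :
    Real.exp (-hdist (origin n) x) = (1 - ‖(x : E n)‖) / (1 + ‖(x : E n)‖) := by
  have hx : ‖(x : E n)‖ < 1 := mem_ball_zero_iff.1 x.2
  have h0 : 0 ≤ ‖(x : E n)‖ := norm_nonneg _
  have hp : 0 < 1 - ‖(x : E n)‖ ^ 2 := by nlinarith
  have hd : dist ((origin n : Ball n) : E n) (x : E n) = ‖(x : E n)‖ := by simp [origin]
  have ho : ‖((origin n : Ball n) : E n)‖ = 0 := by simp [origin]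
  unfold hdist
  rw [hd, ho]
  generalize ‖(x : E n)‖ = t at *
  have e1 : (1 - (0 : ℝ) ^ 2) * (1 - t ^ 2) = 1 - t ^ 2 := by ring
  rw [e1]
  have hs : 0 < √(1 - t ^ 2) := Real.sqrt_pos.2 hp
  have hs2 : √(1 - t ^ 2) ^ 2 = 1 - t ^ 2 := Real.sq_sqrt hp.le
  have e2 : √(1 + (t / √(1 - t ^ 2)) ^ 2) = 1 / √(1 - t ^ 2) := by
    rw [Real.sqrt_eq_iff_mul_self_eq (by positivity) (by positivity)]
    field_simp
    rw [hs2]; ring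
  have e3 : Real.exp (2 * Real.arsinh (t / √(1 - t ^ 2))) = (1 + t) / (1 - t) := by
    rw [two_mul, Real.exp_add, Real.exp_arsinh, e2]
    have h1 : 1 - t ≠ 0 := by linarith
    field_simp
    rw [hs2]; ring
  rw [Real.exp_neg, e3, inv_div]

/-- `g` is an isometry of the hyperbolic ball (bijective, since it is a permutation). -/
def IsHypIsometry {n : ℕ} (g : Equiv.Perm (Ball n)) : Prop :=
  ∀ x y : Ball n, hdist (g x) (g y) = hdist x y

/-- `g` is differentiable, with a derivative of positive determinant, at each point of the open
unit ball (the value chosen off the ball is irrelevant). -/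
def IsOrientationPreserving {n : ℕ} (g : Equiv.Perm (Ball n)) : Prop :=
  ∀ x : Ball n, ∃ A : E n →L[ℝ] E n,
    HasFDerivAt (Function.extend (Subtype.val : Ball n → E n) (fun y => (g y : E n)) 0) A x ∧
      0 < LinearMap.det (A : E n →ₗ[ℝ] E n)

/-- A Kleinian group: a discrete group of orientation preserving isometries of the hyperbolic ball.
Discreteness refers to the topology of pointwise convergence, which on the isometry group
is the same as the compact-open topology. -/
structure IsKleinian {n : ℕ} (Γ : Subgroup (Equiv.Perm (Ball n))) : Prop where
  isometry : ∀ g ∈ Γ, IsHypIsometry g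
  orientation : ∀ g ∈ Γ, IsOrientationPreserving g
  discrete : DiscreteTopology
    ((fun g : Equiv.Perm (Ball n) => (g : Ball n → Ball n)) '' (Γ : Set (Equiv.Perm (Ball n))))

/-- The orbit `Γ(0)`, as a subset of `ℝⁿ`. -/
def orbit {n : ℕ} (Γ : Subgroup (Equiv.Perm (Ball n))) : Set (E n) :=
  (fun g : Equiv.Perm (Ball n) => (g (origin n) : E n)) '' (Γ : Set (Equiv.Perm (Ball n)))

/-- The limit set of a subset of the ball, with the Euclidean closure. -/
def limitSet {n : ℕ} (X : Set (E n)) : Set (E n) := closure X \ X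

/-- The radial limit set of a subset of the ball. -/
def radialLimitSet {n : ℕ} (X : Set (E n)) : Set (E n) :=
  {z | ‖z‖ = 1 ∧ ∃ c : ℝ, 1 ≤ c ∧ ∀ r : ℝ, 0 < r →
    ∃ x ∈ X, ‖z - x‖ ≤ c * (1 - ‖x‖) ∧ c * (1 - ‖x‖) ≤ c * r}

/-- A group is non-elementary if its limit set has more than two points. -/
def IsNonElementary {n : ℕ} (Γ : Subgroup (Equiv.Perm (Ball n))) : Prop :=
  2 < (limitSet (orbit Γ)).encard

/-- The Poincaré series `∑_{g ∈ Γ} exp (-s d(0, g 0))`, with values in `[0, ∞]`. -/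
def poincareSeries {n : ℕ} (Γ : Subgroup (Equiv.Perm (Ball n))) (s : ℝ≥0) : ℝ≥0∞ :=
  ∑' g : Γ, ENNReal.ofReal
    (Real.exp (-((s : ℝ) * hdist (origin n) ((g : Equiv.Perm (Ball n)) (origin n)))))

/-- The Poincaré exponent `inf {s ≥ 0 : P_Γ(s) < ∞}`, with `inf ∅ = ∞`. -/
def poincareExponent {n : ℕ} (Γ : Subgroup (Equiv.Perm (Ball n))) : ℝ≥0∞ :=
  ⨅ (s : ℝ≥0) (_ : poincareSeries Γ s < ∞), (s : ℝ≥0∞)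

/-- The accumulation series `∑_{x ∈ X} (1 - |x|)^s`, with values in `[0, ∞]`. -/
def accumulationSeries {n : ℕ} (X : Set (E n)) (s : ℝ≥0) : ℝ≥0∞ :=
  ∑' x : X, ENNReal.ofReal ((1 - ‖(x : E n)‖) ^ (s : ℝ))

/-- The critical exponent `inf {s ≥ 0 : S_X(s) < ∞}`, with `inf ∅ = ∞`. -/
def criticalExponent {n : ℕ} (X : Set (E n)) : ℝ≥0∞ :=
  ⨅ (s : ℝ≥0) (_ : accumulationSeries X s < ∞), (s : ℝ≥0∞)

/-- The largest number of pairwise disjoint closed balls of radius `r` with centres in `F`. -/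
def packingCount {n : ℕ} (F : Set (E n)) (r : ℝ) : ℕ∞ :=
  ⨆ (C : Set (E n)) (_ : C ⊆ F)
    (_ : C.PairwiseDisjoint (fun x => Metric.closedBall x r)), C.encard

/-- The upper box dimension `limsup_{r → 0} log N_r(F) / (-log r)`. The quotient is nonnegative for
`r < 1` and nonempty `F`, so that the conversion to `[0, ∞]` changes nothing; for `F = ∅` the
value is `0`. -/
def upperBoxDim {n : ℕ} (F : Set (E n)) : ℝ≥0∞ :=
  limsup (fun r : ℝ =>
    (ENNReal.log (packingCount F r : ℝ≥0∞) / ((-Real.log r : ℝ) : EReal)).toENNReal) (𝓝[>] 0)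

end HypBall

end

/-!
The distance formula of the ball model says that a hyperbolic isometry `g` preserves
`|x - y|² / ((1 - |x|²) (1 - |y|²))`. The whole argument rests on this identity; neither geodesics
nor the action of `Γ` on the sphere are needed.

*Proper discontinuity.* By the identity, isometries that displace the centre by a bounded amount
keep each point in a compact part of the ball, so infinitely many of them in `Γ` would contain two
that almost agree on finitely many points, against discreteness
(`HypBall.IsKleinian.finite_setOf_norm_le`). Hence the stabiliser of the centre is finite, the
limit set lies on the sphere, and the orbit is uniformly separated. Finiteness of the stabiliser
makes the Poincaré series comparable to the accumulation series, since `exp (-d(0, x))` is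
`(1 - |x|) / (1 + |x|)`; so both exponents agree.

*First inequality.* If the accumulation series converges at `s`, the balls of radius `c (1 - |x|)`
about the orbit points near the sphere cover the radial limit points with constant `c`, and bound
their `s`-dimensional Hausdorff measure by a multiple of the series
(`HypBall.dimH_radialLimitSet_le`).

*Second inequality.* For points `a`, `b` of the ball, the identity applied to the pairs from
`a`, `b`, `0` gives `|a - b| min (|g a - g 0|, |g b - g 0|) ≤ 2 (1 - |g 0|²)`
(`HypBall.IsHypIsometry.dist_mul_dist_le`). Letting `a` and `b` tend along the orbit to two distinct
limit points shows that every orbit point `x` is within `C (1 - |x|)` of the limit set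
(`HypBall.IsKleinian.exists_dist_limitSet_le`). So the orbit points with `1 - |x|` in `(r / 2, r]`
lie near the centres of a maximal packing of the limit set by `r`-balls, boundedly many near each,
and their number is at most `K N_r` (`HypBall.IsKleinian.exists_encard_shell_le`). Summation over
`r = 2⁻ᵏ` gives convergence of the accumulation series above the upper box dimension.
-/

namespace HypBall

variable {n : ℕ}

/-! ### The distance identity for hyperbolic isometries -/

/-- The quantity `1 - |x|²`, which is comparable to the Euclidean distance from `x` to the sphere
and is the conformal weight in the formula for the hyperbolic distance. -/
noncomputable def defect (x : Ball n) : ℝ := 1 - ‖(x : E n)‖ ^ 2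

theorem norm_lt_one (x : Ball n) : ‖(x : E n)‖ < 1 := mem_ball_zero_iff.1 x.2

theorem defect_pos (x : Ball n) : 0 < defect x := by
  have := norm_lt_one x
  have := norm_nonneg (x : E n)
  unfold defect
  nlinarith

theorem defect_le_one (x : Ball n) : defect x ≤ 1 := by
  have := sq_nonneg ‖(x : E n)‖
  unfold defect
  linarith

theorem defect_le_two_mul (x : Ball n) : defect x ≤ 2 * (1 - ‖(x : E n)‖) := by
  have := sq_nonneg (1 - ‖(x : E n)‖)
  unfold defect
  nlinarith

theorem one_sub_norm_le_defect (x : Ball n) : 1 - ‖(x : E n)‖ ≤ defect x := by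
  have := norm_lt_one x
  have := norm_nonneg (x : E n)
  unfold defect
  nlinarith

@[simp] theorem coe_origin : ((origin n : Ball n) : E n) = 0 := rfl

@[simp] theorem defect_origin : defect (origin n) = 1 := by simp [defect]

/-- A hyperbolic isometry preserves `|x - y|² / ((1 - |x|²) (1 - |y|²))`, the square of the
hyperbolic sine of half the hyperbolic distance. -/
theorem IsHypIsometry.dist_sq_mul {g : Equiv.Perm (Ball n)} (hg : IsHypIsometry g)
    (x y : Ball n) :
    dist (g x : E n) (g y) ^ 2 * (defect x * defect y) =
      dist (x : E n) y ^ 2 * (defect (g x) * defect (g y)) := by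
  have h := hg x y
  unfold hdist at h
  have h1 := Real.arsinh_injective (mul_left_cancel₀ two_ne_zero h)
  have p1 : 0 < defect (g x) * defect (g y) := mul_pos (defect_pos _) (defect_pos _)
  have p2 : 0 < defect x * defect y := mul_pos (defect_pos _) (defect_pos _)
  have h2 := congrArg (· ^ 2) h1
  change (_ / √(defect (g x) * defect (g y))) ^ 2 = (_ / √(defect x * defect y)) ^ 2 at h2
  rw [div_pow, div_pow, Real.sq_sqrt p1.le, Real.sq_sqrt p2.le,
    div_eq_div_iff p1.ne' p2.ne'] at h2
  exact h2

theorem IsHypIsometry.dist_origin_sq_mul {g : Equiv.Perm (Ball n)} (hg : IsHypIsometry g)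
    (x : Ball n) :
    dist (g x : E n) (g (origin n)) ^ 2 * defect x =
      ‖(x : E n)‖ ^ 2 * (defect (g x) * defect (g (origin n))) := by
  simpa using hg.dist_sq_mul x (origin n)

theorem IsHypIsometry.dist_mul_dist_le_of_le {g : Equiv.Perm (Ball n)} (hg : IsHypIsometry g)
    {a b : Ball n}
    (hab : dist (g b : E n) (g (origin n)) ≤ dist (g a : E n) (g (origin n))) :
    dist (a : E n) b * dist (g b : E n) (g (origin n)) ≤ 2 * defect (g (origin n)) := by
  have ha := hg.dist_origin_sq_mul a
  have hb := hg.dist_origin_sq_mul b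
  have hw := hg.dist_sq_mul a b
  have htri : dist (g a : E n) (g b) ≤ 2 * dist (g a : E n) (g (origin n)) := by
    have := dist_triangle_right (g a : E n) (g b) (g (origin n))
    linarith
  have ha1 := (norm_lt_one a).le
  have hb1 := (norm_lt_one b).le
  have hA := defect_pos a
  have hB := defect_pos b
  have hA' := defect_pos (g a)
  have hB' := defect_pos (g b)
  have hc := defect_pos (g (origin n))
  have hu := dist_nonneg (x := (g a : E n)) (y := (g (origin n)))
  have hv := dist_nonneg (x := (g b : E n)) (y := (g (origin n)))
  have hw0 := dist_nonneg (x := (g a : E n)) (y := (g b))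
  have hD := dist_nonneg (x := (a : E n)) (y := b)
  have na := norm_nonneg (a : E n)
  have nb := norm_nonneg (b : E n)
  generalize dist (g a : E n) (g (origin n)) = u at *
  generalize dist (g b : E n) (g (origin n)) = v at *
  generalize dist (g a : E n) (g b) = w at *
  generalize dist (a : E n) b = D at *
  generalize ‖(a : E n)‖ = s at *
  generalize ‖(b : E n)‖ = t at *
  generalize defect (g (origin n)) = c at *
  generalize defect (g a) = A' at *
  generalize defect (g b) = B' at *
  generalize defect a = A at *
  generalize defect b = B at *
  have hs : s ^ 2 ≤ 1 := by nlinarith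
  have ht : t ^ 2 ≤ 1 := by nlinarith
  have h1 : u ^ 2 * A ≤ A' * c := by
    rw [ha]
    exact mul_le_of_le_one_left (by positivity) hs
  have h2 : v ^ 2 * B ≤ B' * c := by
    rw [hb]
    exact mul_le_of_le_one_left (by positivity) ht
  have hw2 : w ^ 2 ≤ 4 * u ^ 2 := by nlinarith
  have h3 : D ^ 2 * B' ≤ 4 * c * B := by
    have : (D ^ 2 * B') * A' ≤ (4 * c * B) * A' := by
      calc (D ^ 2 * B') * A' = w ^ 2 * (A * B) := by rw [hw]; ring
        _ ≤ 4 * u ^ 2 * (A * B) := by gcongr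
        _ = 4 * B * (u ^ 2 * A) := by ring
        _ ≤ 4 * B * (A' * c) := by gcongr
        _ = _ := by ring
    exact le_of_mul_le_mul_right this hA'
  have h4 : (D * v) ^ 2 ≤ (2 * c) ^ 2 := by
    have : (D * v) ^ 2 * B ≤ (2 * c) ^ 2 * B := by
      calc (D * v) ^ 2 * B = D ^ 2 * (v ^ 2 * B) := by ring
        _ ≤ D ^ 2 * (B' * c) := by gcongr
        _ = (D ^ 2 * B') * c := by ring
        _ ≤ (4 * c * B) * c := by gcongr
        _ = _ := by ring
    exact le_of_mul_le_mul_right this hB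
  exact (sq_le_sq₀ (by positivity) (by positivity)).1 h4

/-- Of two points `a`, `b` at definite Euclidean distance, one is mapped by any isometry `g` close
to `g 0`, on the scale of the distance of `g 0` to the sphere. Geometrically: a geodesic through a
point near `g 0` has an endpoint in the shadow of `g 0`. -/
theorem IsHypIsometry.dist_mul_dist_le {g : Equiv.Perm (Ball n)} (hg : IsHypIsometry g)
    (a b : Ball n) :
    dist (a : E n) b * dist (g a : E n) (g (origin n)) ≤ 2 * defect (g (origin n)) ∨
      dist (a : E n) b * dist (g b : E n) (g (origin n)) ≤ 2 * defect (g (origin n)) := by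
  rcases le_total (dist (g b : E n) (g (origin n))) (dist (g a : E n) (g (origin n))) with h | h
  · exact Or.inr (hg.dist_mul_dist_le_of_le h)
  · left
    rw [dist_comm (a : E n)]
    exact hg.dist_mul_dist_le_of_le h

/-! ### Proper discontinuity -/

/-- The image of `x` under an isometry stays away from the sphere, uniformly over the isometries
that displace the centre by a bounded amount. -/
theorem IsHypIsometry.le_defect_apply {g : Equiv.Perm (Ball n)} (hg : IsHypIsometry g)
    {ρ : ℝ} (hρ : ρ < 1) (h0 : ‖(g (origin n) : E n)‖ ≤ ρ) (x : Ball n) :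
    ((1 - ρ) / 2) ^ 2 * defect x ≤ defect (g x) := by
  have hx := defect_pos x
  have hx1 := defect_le_one x
  have hgx := defect_pos (g x)
  have hc := defect_pos (g (origin n))
  have hc1 := defect_le_one (g (origin n))
  have hρ0 : 0 ≤ ρ := (norm_nonneg _).trans h0
  rcases le_total ‖(g x : E n)‖ ((1 + ρ) / 2) with h | h
  · have := norm_nonneg (g x : E n)
    calc ((1 - ρ) / 2) ^ 2 * defect x ≤ ((1 - ρ) / 2) ^ 2 * 1 := by gcongr
      _ ≤ 1 - ((1 + ρ) / 2) ^ 2 := by nlinarith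
      _ ≤ defect (g x) := by unfold defect; gcongr
  · have hd : (1 - ρ) / 2 ≤ dist (g x : E n) (g (origin n)) := by
      have := norm_sub_norm_le (g x : E n) (g (origin n))
      rw [dist_eq_norm]
      linarith
    calc ((1 - ρ) / 2) ^ 2 * defect x
        ≤ dist (g x : E n) (g (origin n)) ^ 2 * defect x := by gcongr
      _ = ‖(x : E n)‖ ^ 2 * (defect (g x) * defect (g (origin n))) := hg.dist_origin_sq_mul x
      _ ≤ 1 * (defect (g x) * 1) := by
          gcongr
          exact pow_le_one₀ (norm_nonneg _) (norm_lt_one x).le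
      _ = defect (g x) := by ring

theorem exists_ne_dist_lt_of_infinite {ι : Type*} [Infinite ι] {X : Type*} [PseudoMetricSpace X]
    [ProperSpace X] (f : ι → X) (hf : Bornology.IsBounded (range f)) {ε : ℝ} (hε : 0 < ε) :
    ∃ i j, i ≠ j ∧ dist (f i) (f j) < ε := by
  obtain ⟨t, -, htf, ht⟩ :=
    finite_cover_balls_of_compact hf.isCompact_closure (half_pos hε)
  have h : ∀ i, ∃ c ∈ t, dist (f i) c < ε / 2 := fun i => by
    simpa using ht (subset_closure (mem_range_self i))
  choose c hct hc using h
  have : Finite t := htf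
  obtain ⟨i, j, hij, he⟩ := Finite.exists_ne_map_eq_of_infinite (fun i => (⟨c i, hct i⟩ : t))
  have he' : c i = c j := congrArg Subtype.val he
  refine ⟨i, j, hij, ?_⟩
  have h1 := hc i
  have h2 := hc j
  rw [← he'] at h2
  have := dist_triangle_right (f i) (f j) (c i)
  linarith

/-- Discreteness at the identity: finitely many test points and one radius isolate it. -/
theorem IsKleinian.exists_isolating {Γ : Subgroup (Equiv.Perm (Ball n))} (hΓ : IsKleinian Γ) :
    ∃ (I : Finset (Ball n)) (ε : ℝ), 0 < ε ∧
      ∀ g ∈ Γ, (∀ x ∈ I, dist (g x : E n) x < ε) → g = 1 := by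
  have hd := hΓ.discrete
  set S := (fun g : Equiv.Perm (Ball n) => (g : Ball n → Ball n)) ''
    (Γ : Set (Equiv.Perm (Ball n))) with hS
  let e : S := ⟨_, 1, Γ.one_mem, rfl⟩
  obtain ⟨U, hU, hUe⟩ := isOpen_induced_iff.1 (isOpen_discrete ({e} : Set S))
  have heU : (id : Ball n → Ball n) ∈ U := by
    have : e ∈ Subtype.val ⁻¹' U := by rw [hUe]; rfl
    exact this
  obtain ⟨I, u, hu, hIu⟩ := isOpen_pi_iff.1 hU _ heU
  have hev : ∀ᶠ ε : ℝ in 𝓝[>] 0, ∀ x ∈ I, Metric.ball x ε ⊆ u x := by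
    rw [Filter.eventually_all_finset]
    intro x hx
    obtain ⟨δ, hδ, hb⟩ := Metric.isOpen_iff.1 (hu x hx).1 x (hu x hx).2
    filter_upwards [Ioo_mem_nhdsGT hδ] with ε hε
    exact (Metric.ball_subset_ball hε.2.le).trans hb
  obtain ⟨ε, hε, hpos⟩ := (hev.and self_mem_nhdsWithin).exists
  refine ⟨I, ε, hpos, fun g hg h => ?_⟩
  have hgU : (g : Ball n → Ball n) ∈ U := hIu fun x hx => hε x hx (h x hx)
  have hge : (⟨_, g, hg, rfl⟩ : S) ∈ ({e} : Set S) := by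
    rw [← hUe]
    exact hgU
  have := congrArg Subtype.val hge
  exact Equiv.coe_fn_injective this

/-- A Kleinian group acts properly discontinuously: only finitely many elements displace the
centre by a bounded amount. Infinitely many such elements would contain two that almost agree on
the test points isolating the identity. -/
theorem IsKleinian.finite_setOf_norm_le {Γ : Subgroup (Equiv.Perm (Ball n))} (hΓ : IsKleinian Γ)
    {ρ : ℝ} (hρ : ρ < 1) : {g | g ∈ Γ ∧ ‖(g (origin n) : E n)‖ ≤ ρ}.Finite := by
  obtain ⟨I, ε, hε, hI⟩ := hΓ.exists_isolating
  by_contra hinf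
  have : Infinite {g | g ∈ Γ ∧ ‖(g (origin n) : E n)‖ ≤ ρ} := Set.infinite_coe_iff.2 hinf
  let m : I → ℝ := fun x => ((1 - ρ) / 2) ^ 2 * defect (x : Ball n)
  have hm : ∀ x, 0 < m x := fun x =>
    mul_pos (pow_pos (by linarith) 2) (defect_pos _)
  -- Division by the lower bound `m x` of the defect makes one `ε` serve for all test points.
  let f : {g | g ∈ Γ ∧ ‖(g (origin n) : E n)‖ ≤ ρ} → (I → E n) :=
    fun g x => (m x)⁻¹ • ((g : Equiv.Perm (Ball n)) x : E n)
  have hf : Bornology.IsBounded (range f) := by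
    rw [Bornology.forall_isBounded_image_eval_iff.symm]
    intro x
    refine (Metric.isBounded_closedBall (x := (0 : E n)) (r := (m x)⁻¹)).subset ?_
    rintro _ ⟨_, ⟨g, rfl⟩, rfl⟩
    have h1 := (norm_lt_one ((g : Equiv.Perm (Ball n)) x)).le
    have h2 := inv_pos.2 (hm x)
    simp only [Function.eval, f, mem_closedBall_zero_iff, norm_smul, Real.norm_eq_abs,
      abs_of_pos h2]
    exact mul_le_of_le_one_right h2.le h1
  obtain ⟨⟨g, hg, hgρ⟩, ⟨h, hh, hhρ⟩, hne, hd⟩ := exists_ne_dist_lt_of_infinite f hf hε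
  refine hne (Subtype.ext ?_)
  have key : g⁻¹ * h = 1 := by
    refine hI _ (Γ.mul_mem (Γ.inv_mem hg) hh) fun x hx => ?_
    have hmx := hm ⟨x, hx⟩
    have hdx : dist (g x : E n) (h x) < ε * m ⟨x, hx⟩ := by
      have := (dist_le_pi_dist _ _ (⟨x, hx⟩ : I)).trans_lt hd
      simp only [f] at this
      rw [dist_smul₀, Real.norm_eq_abs, abs_of_pos (inv_pos.2 hmx), inv_mul_lt_iff₀ hmx] at this
      linarith
    have hgx := (hΓ.isometry g hg).le_defect_apply hρ hgρ x
    have hhx := (hΓ.isometry h hh).le_defect_apply hρ hhρ x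
    change m ⟨x, hx⟩ ≤ _ at hgx hhx
    have e := (hΓ.isometry g hg).dist_sq_mul ((g⁻¹ * h) x) x
    have e1 : g ((g⁻¹ * h) x) = h x := by simp
    rw [e1, dist_comm] at e
    have hlt : dist ((g⁻¹ * h) x : E n) x ^ 2 * m ⟨x, hx⟩ ^ 2 < ε ^ 2 * m ⟨x, hx⟩ ^ 2 := by
      calc dist ((g⁻¹ * h) x : E n) x ^ 2 * m ⟨x, hx⟩ ^ 2
          ≤ dist ((g⁻¹ * h) x : E n) x ^ 2 * (defect (h x) * defect (g x)) := by
            rw [sq (m _)]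
            gcongr
            exact (defect_pos _).le
        _ = dist (g x : E n) (h x) ^ 2 * (defect ((g⁻¹ * h) x) * defect x) := e.symm
        _ ≤ dist (g x : E n) (h x) ^ 2 * (1 * 1) := by
            have := defect_le_one ((g⁻¹ * h) x)
            have := defect_le_one x
            have := defect_pos x
            gcongr
        _ < (ε * m ⟨x, hx⟩) ^ 2 := by
            rw [mul_one, mul_one]
            gcongr
        _ = _ := by ring
    exact lt_of_pow_lt_pow_left₀ 2 hε.le (lt_of_mul_lt_mul_right hlt (by positivity))
  exact inv_mul_eq_one.1 key

theorem IsKleinian.finite_orbit_inter {Γ : Subgroup (Equiv.Perm (Ball n))} (hΓ : IsKleinian Γ)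
    {ρ : ℝ} (hρ : ρ < 1) : (orbit Γ ∩ Metric.closedBall 0 ρ).Finite := by
  refine ((hΓ.finite_setOf_norm_le hρ).image fun g => (g (origin n) : E n)).subset ?_
  rintro _ ⟨⟨g, hg, rfl⟩, hx⟩
  exact ⟨g, ⟨hg, mem_closedBall_zero_iff.1 hx⟩, rfl⟩

theorem norm_lt_one_of_mem_orbit {Γ : Subgroup (Equiv.Perm (Ball n))} {x : E n}
    (hx : x ∈ orbit Γ) : ‖x‖ < 1 := by
  obtain ⟨g, -, rfl⟩ := hx
  exact norm_lt_one _

/-- Distinct orbit points are uniformly separated in the hyperbolic metric. -/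
theorem IsKleinian.exists_orbit_separated {Γ : Subgroup (Equiv.Perm (Ball n))}
    (hΓ : IsKleinian Γ) :
    ∃ c : ℝ, 0 < c ∧ ∀ x ∈ orbit Γ, ∀ y ∈ orbit Γ, x ≠ y →
      c ^ 2 * ((1 - ‖x‖) * (1 - ‖y‖)) ≤ dist x y ^ 2 := by
  have hfin : ((orbit Γ ∩ Metric.closedBall 0 (1 / 2)) \ {0}).Finite :=
    (hΓ.finite_orbit_inter (by norm_num)).subset sdiff_subset
  have hev : ∀ᶠ c : ℝ in 𝓝[>] 0, c < 1 / 2 ∧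
      ∀ x ∈ (orbit Γ ∩ Metric.closedBall 0 (1 / 2)) \ {0}, c < ‖x‖ := by
    refine Eventually.and (mem_of_superset (Ioo_mem_nhdsGT (by norm_num : (0 : ℝ) < 1 / 2))
      fun c hc => hc.2) ((Filter.eventually_all_finite hfin).2 fun x hx => ?_)
    exact mem_of_superset (Ioo_mem_nhdsGT (norm_pos_iff.2 hx.2)) fun c hc => hc.2
  obtain ⟨c, ⟨hc2, hc⟩, hpos⟩ := (hev.and self_mem_nhdsWithin).exists
  have hpos : 0 < c := hpos
  have hnorm : ∀ x ∈ orbit Γ, x ≠ 0 → c ≤ ‖x‖ := fun x hx h0 => by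
    by_cases h : ‖x‖ ≤ 1 / 2
    · exact (hc x ⟨⟨hx, mem_closedBall_zero_iff.2 h⟩, h0⟩).le
    · linarith
  refine ⟨c, hpos, ?_⟩
  rintro _ ⟨g, hg, rfl⟩ _ ⟨h, hh, rfl⟩ hne
  dsimp only at hne ⊢
  have e := (hΓ.isometry g hg).dist_origin_sq_mul ((g⁻¹ * h) (origin n))
  have e1 : g ((g⁻¹ * h) (origin n)) = h (origin n) := by simp
  rw [e1, dist_comm] at e
  have hk : c ≤ ‖((g⁻¹ * h) (origin n) : E n)‖ := by
    refine hnorm _ ⟨g⁻¹ * h, Γ.mul_mem (Γ.inv_mem hg) hh, rfl⟩ fun h0 => hne ?_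
    have : (g⁻¹ * h) (origin n) = origin n := Subtype.ext h0
    rw [← e1, this]
  have l1 := one_sub_norm_le_defect (g (origin n))
  have l2 := one_sub_norm_le_defect (h (origin n))
  have m1 := norm_lt_one (g (origin n))
  have m2 := norm_lt_one (h (origin n))
  calc c ^ 2 * ((1 - ‖(g (origin n) : E n)‖) * (1 - ‖(h (origin n) : E n)‖))
      ≤ ‖((g⁻¹ * h) (origin n) : E n)‖ ^ 2 * (defect (g (origin n)) * defect (h (origin n))) := by
        gcongr
        exact (defect_pos _).le
    _ = dist (g (origin n) : E n) (h (origin n)) ^ 2 * defect ((g⁻¹ * h) (origin n)) := by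
        rw [e]; ring
    _ ≤ _ := mul_le_of_le_one_right (sq_nonneg _) (defect_le_one _)

/-! ### Limit points near orbit points -/

theorem IsKleinian.norm_eq_one_of_mem_limitSet {Γ : Subgroup (Equiv.Perm (Ball n))}
    (hΓ : IsKleinian Γ) {z : E n} (hz : z ∈ limitSet (orbit Γ)) : ‖z‖ = 1 := by
  have hle : ‖z‖ ≤ 1 := by
    have : closure (orbit Γ) ⊆ Metric.closedBall 0 1 :=
      closure_minimal (fun x hx => mem_closedBall_zero_iff.2 (norm_lt_one_of_mem_orbit hx).le)
        Metric.isClosed_closedBall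
    exact mem_closedBall_zero_iff.1 (this hz.1)
  by_contra hne
  have hlt : ‖z‖ < 1 := lt_of_le_of_ne hle hne
  have hρ : (1 + ‖z‖) / 2 < 1 := by linarith
  have hz' : z ∈ closure (orbit Γ ∩ Metric.ball 0 ((1 + ‖z‖) / 2)) := by
    rw [inter_comm]
    exact Metric.isOpen_ball.inter_closure ⟨mem_ball_zero_iff.2 (by linarith), hz.1⟩
  have := closure_mono (inter_subset_inter_right _ Metric.ball_subset_closedBall) hz'
  rw [(hΓ.finite_orbit_inter hρ).isClosed.closure_eq] at this
  exact hz.2 this.1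

theorem mem_limitSet_of_norm_eq_one {Γ : Subgroup (Equiv.Perm (Ball n))} {z : E n}
    (hz : z ∈ closure (orbit Γ)) (h1 : ‖z‖ = 1) : z ∈ limitSet (orbit Γ) :=
  ⟨hz, fun h => (norm_lt_one_of_mem_orbit h).ne h1⟩

theorem IsKleinian.exists_mem_limitSet_of_frequently {Γ : Subgroup (Equiv.Perm (Ball n))}
    (hΓ : IsKleinian Γ) {g : Equiv.Perm (Ball n)} (hg : g ∈ Γ) {a : ℕ → Ball n}
    (ha : ∀ k, ∃ h ∈ Γ, h (origin n) = a k)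
    (ha1 : Tendsto (fun k => ‖(a k : E n)‖) atTop (𝓝 1)) {R : ℝ}
    (hR : ∃ᶠ k in atTop, dist (g (a k) : E n) (g (origin n)) ≤ R) :
    ∃ ζ ∈ limitSet (orbit Γ), dist ζ (g (origin n) : E n) ≤ R := by
  obtain ⟨φ, hφ, hφR⟩ := extraction_of_frequently_atTop hR
  obtain ⟨ζ, hζ, ψ, hψ, hlim⟩ :=
    (isCompact_closedBall (g (origin n) : E n) R).tendsto_subseq
      (x := fun k => (g (a (φ k)) : E n)) fun k => hφR k
  refine ⟨ζ, mem_limitSet_of_norm_eq_one ?_ ?_, hζ⟩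
  · refine mem_closure_of_tendsto hlim (Eventually.of_forall fun k => ?_)
    obtain ⟨h, hh, he⟩ := ha (φ (ψ k))
    exact ⟨g * h, Γ.mul_mem hg hh, by simp [he]⟩
  · have ht : Tendsto (fun k => ‖(a (φ (ψ k)) : E n)‖) atTop (𝓝 1) :=
      ha1.comp (hφ.comp hψ).tendsto_atTop
    have hl : Tendsto (fun k => dist (g (a (φ (ψ k))) : E n) (g (origin n)) ^ 2 *
        defect (a (φ (ψ k)))) atTop (𝓝 (dist ζ (g (origin n) : E n) ^ 2 * (1 - 1 ^ 2))) :=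
      ((hlim.dist tendsto_const_nhds).pow 2).mul (tendsto_const_nhds.sub (ht.pow 2))
    have hr : Tendsto (fun k => ‖(a (φ (ψ k)) : E n)‖ ^ 2 *
        (defect (g (a (φ (ψ k)))) * defect (g (origin n)))) atTop
        (𝓝 (1 ^ 2 * ((1 - ‖ζ‖ ^ 2) * defect (g (origin n))))) :=
      (ht.pow 2).mul ((tendsto_const_nhds.sub (hlim.norm.pow 2)).mul tendsto_const_nhds)
    -- In the limit the distance identity reads `0 = (1 - |ζ|²) (1 - |g 0|²)`.
    have he := tendsto_nhds_unique hl
      (hr.congr fun k => ((hΓ.isometry g hg).dist_origin_sq_mul _).symm)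
    have hc := defect_pos (g (origin n))
    have h0 : (1 - ‖ζ‖ ^ 2) * defect (g (origin n)) = 0 := by linarith
    have h1 : ‖ζ‖ ^ 2 = 1 := by
      rcases mul_eq_zero.1 h0 with h | h
      · linarith
      · exact absurd h hc.ne'
    exact (pow_eq_one_iff_of_nonneg (norm_nonneg _) two_ne_zero).1 h1

/-- If the limit set has two points, each orbit point `x` lies within a fixed multiple of its
distance to the sphere from the limit set. -/
theorem IsKleinian.exists_dist_limitSet_le {Γ : Subgroup (Equiv.Perm (Ball n))}
    (hΓ : IsKleinian Γ) (hne : (limitSet (orbit Γ)).Nontrivial) :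
    ∃ C : ℝ, 0 < C ∧ ∀ x ∈ orbit Γ, ∃ ζ ∈ limitSet (orbit Γ), dist ζ x ≤ C * (1 - ‖x‖) := by
  obtain ⟨ξ, hξ, η, hη, hξη⟩ := hne
  have hD := dist_pos.2 hξη
  refine ⟨8 / dist ξ η, by positivity, ?_⟩
  rintro _ ⟨g, hg, rfl⟩
  have lift : ∀ z ∈ limitSet (orbit Γ), ∃ a : ℕ → Ball n, (∀ k, ∃ h ∈ Γ, h (origin n) = a k) ∧
      Tendsto (fun k => (a k : E n)) atTop (𝓝 z) := fun z hz => by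
    obtain ⟨x, hx, hlim⟩ := mem_closure_iff_seq_limit.1 hz.1
    choose h hh he using hx
    exact ⟨fun k => h k (origin n), fun k => ⟨h k, hh k, rfl⟩, hlim.congr fun k => (he k).symm⟩
  obtain ⟨a, ha, hal⟩ := lift ξ hξ
  obtain ⟨b, hb, hbl⟩ := lift η hη
  have hev : ∀ᶠ k in atTop, dist ξ η / 2 < dist (a k : E n) (b k) :=
    (hal.dist hbl).eventually (lt_mem_nhds (half_lt_self hD))
  have hor : ∃ᶠ k in atTop,
      dist (g (a k) : E n) (g (origin n)) ≤ 8 / dist ξ η * (1 - ‖(g (origin n) : E n)‖) ∨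
      dist (g (b k) : E n) (g (origin n)) ≤ 8 / dist ξ η * (1 - ‖(g (origin n) : E n)‖) := by
    refine (hev.mono fun k hk => ?_).frequently
    have hq := defect_le_two_mul (g (origin n))
    have aux : ∀ v : ℝ, 0 ≤ v → dist (a k : E n) (b k) * v ≤ 2 * defect (g (origin n)) →
        v ≤ 8 / dist ξ η * (1 - ‖(g (origin n) : E n)‖) := fun v hv h => by
      rw [div_mul_eq_mul_div, le_div_iff₀ hD]
      nlinarith
    exact ((hΓ.isometry g hg).dist_mul_dist_le (a k) (b k)).imp (aux _ dist_nonneg)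
      (aux _ dist_nonneg)
  rcases frequently_or_distrib.1 hor with h | h
  · exact hΓ.exists_mem_limitSet_of_frequently hg ha
      (by simpa only [hΓ.norm_eq_one_of_mem_limitSet hξ] using hal.norm) h
  · exact hΓ.exists_mem_limitSet_of_frequently hg hb
      (by simpa only [hΓ.norm_eq_one_of_mem_limitSet hη] using hbl.norm) h

/-! ### Counting orbit points in shells -/

/-- Separated subsets of a ball have boundedly many points, with a bound that depends only on the
ratio of the radius of the ball to the separation. -/
theorem exists_encard_le_of_separated (n : ℕ) (ρ : ℝ) {σ : ℝ} (hσ : 0 < σ) :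
    ∃ K : ℕ, ∀ (z : E n) (r : ℝ), 0 < r → ∀ S : Set (E n), S ⊆ Metric.closedBall z (ρ * r) →
      (∀ x ∈ S, ∀ y ∈ S, x ≠ y → σ * r ≤ dist x y) → S.encard ≤ K := by
  obtain ⟨t, -, htf, ht⟩ := finite_cover_balls_of_compact
    (isCompact_closedBall (0 : E n) ρ) (half_pos hσ)
  refine ⟨htf.toFinset.card, fun z r hr S hS hsep => ?_⟩
  have h : ∀ x : E n, ∃ c, x ∈ S → c ∈ t ∧ dist (r⁻¹ • (x - z)) c < σ / 2 := fun x => by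
    by_cases hx : x ∈ S
    · have : r⁻¹ • (x - z) ∈ Metric.closedBall (0 : E n) ρ := by
        have := hS hx
        rw [Metric.mem_closedBall, dist_eq_norm] at this
        rw [mem_closedBall_zero_iff, norm_smul, Real.norm_eq_abs, abs_of_pos (inv_pos.2 hr),
          inv_mul_le_iff₀ hr]
        linarith
      obtain ⟨c, hc, hd⟩ := mem_iUnion₂.1 (ht this)
      exact ⟨c, fun _ => ⟨hc, hd⟩⟩
    · exact ⟨0, fun h => absurd h hx⟩
  choose f hf using h
  have hinj : InjOn f S := fun x hx y hy he => by
    by_contra hne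
    have h1 := (hf x hx).2
    have h2 := (hf y hy).2
    rw [← he] at h2
    have h3 := dist_triangle_right (r⁻¹ • (x - z)) (r⁻¹ • (y - z)) (f x)
    rw [dist_smul₀, Real.norm_eq_abs, abs_of_pos (inv_pos.2 hr), dist_sub_right] at h3
    have h4 : r⁻¹ * dist x y < σ := by linarith
    rw [inv_mul_lt_iff₀ hr] at h4
    have := hsep x hx y hy hne
    linarith
  calc S.encard ≤ t.encard := encard_le_encard_of_injOn (fun x hx => (hf x hx).1) hinj
    _ = _ := htf.encard_eq_coe_toFinset_card

/-- The points of `X` whose distance to the unit sphere is in `(r / 2, r]`. -/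
def shell (X : Set (E n)) (r : ℝ) : Set (E n) := {x ∈ X | r / 2 < 1 - ‖x‖ ∧ 1 - ‖x‖ ≤ r}

theorem IsKleinian.finite_shell {Γ : Subgroup (Equiv.Perm (Ball n))} (hΓ : IsKleinian Γ)
    {r : ℝ} (hr : 0 < r) : (shell (orbit Γ) r).Finite := by
  refine (hΓ.finite_orbit_inter (ρ := 1 - r / 2) (by linarith)).subset fun x hx => ⟨hx.1, ?_⟩
  have := hx.2.1
  exact mem_closedBall_zero_iff.2 (by linarith)

/-- The number of orbit points in a shell is controlled by the packing number of the limit set at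
the scale of the shell: each orbit point is near the centre of a ball of a maximal packing, and by
separation each ball serves boundedly many orbit points. -/
theorem IsKleinian.exists_encard_shell_le {Γ : Subgroup (Equiv.Perm (Ball n))}
    (hΓ : IsKleinian Γ) (hne : (limitSet (orbit Γ)).Nontrivial) :
    ∃ K : ℕ, ∀ r : ℝ, 0 < r →
      (shell (orbit Γ) r).encard ≤ K * packingCount (limitSet (orbit Γ)) r := by
  classical
  obtain ⟨c, hc, hsep⟩ := hΓ.exists_orbit_separated
  obtain ⟨C, hC, hnear⟩ := hΓ.exists_dist_limitSet_le hne
  obtain ⟨K, hK⟩ := exists_encard_le_of_separated n (C + 4) (half_pos hc)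
  refine ⟨K, fun r hr => ?_⟩
  obtain ⟨P, hPL, hPd, hPc⟩ := Vitali.exists_disjoint_subfamily_covering_enlargement_closedBall
    (limitSet (orbit Γ)) id (fun _ => r) r (fun _ _ => le_rfl) 4 (by norm_num)
  have hfin := hΓ.finite_shell hr
  have h : ∀ x : E n, ∃ p, x ∈ shell (orbit Γ) r → p ∈ P ∧ dist x p ≤ (C + 4) * r := fun x => by
    by_cases hx : x ∈ shell (orbit Γ) r
    · obtain ⟨ζ, hζ, hd⟩ := hnear x hx.1
      obtain ⟨p, hp, hsub⟩ := hPc ζ hζ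
      have h1 : dist ζ p ≤ 4 * r := hsub (Metric.mem_closedBall_self hr.le)
      have h2 : C * (1 - ‖x‖) ≤ C * r := mul_le_mul_of_nonneg_left hx.2.2 hC.le
      have h3 := dist_triangle_left x p ζ
      exact ⟨p, fun _ => ⟨hp, by linarith⟩⟩
    · exact ⟨0, fun h => absurd h hx⟩
  choose f hf using h
  have hfib : ∀ p ∈ hfin.toFinset.image f, (hfin.toFinset.filter fun x => f x = p).card ≤ K := by
    intro p _
    have := hK p r hr (hfin.toFinset.filter fun x => f x = p : Finset (E n)) (fun x hx => ?_) ?_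
    · rwa [encard_coe_eq_coe_finsetCard, Nat.cast_le] at this
    · simp only [Finset.coe_filter, Finite.mem_toFinset, mem_ofPred_eq] at hx
      have := (hf x hx.1).2
      rwa [hx.2] at this
    · intro x hx y hy hxy
      simp only [Finset.coe_filter, Finite.mem_toFinset, mem_ofPred_eq] at hx hy
      have h1 := hsep x hx.1.1 y hy.1.1 hxy
      have h2 := hx.1.2.1
      have h3 := hy.1.2.1
      refine (sq_le_sq₀ (by positivity) dist_nonneg).1 ?_
      calc (c / 2 * r) ^ 2 = c ^ 2 * (r / 2 * (r / 2)) := by ring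
        _ ≤ c ^ 2 * ((1 - ‖x‖) * (1 - ‖y‖)) := by gcongr; linarith
        _ ≤ _ := h1
  have hcard := Finset.card_le_mul_card_image hfin.toFinset K hfib
  have hP : P.encard ≤ packingCount (limitSet (orbit Γ)) r :=
    le_iSup_of_le P (le_iSup_of_le hPL (le_iSup_of_le hPd le_rfl))
  calc (shell (orbit Γ) r).encard = (hfin.toFinset.card : ℕ∞) := hfin.encard_eq_coe_toFinset_card
    _ ≤ ((K * (hfin.toFinset.image f).card : ℕ) : ℕ∞) := by exact_mod_cast hcard
    _ = K * (hfin.toFinset.image f : Set (E n)).encard := by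
        rw [encard_coe_eq_coe_finsetCard]; push_cast; rfl
    _ ≤ K * P.encard := by
        gcongr
        intro p hp
        simp only [Finset.coe_image, Finite.coe_toFinset] at hp
        obtain ⟨x, hx, rfl⟩ := hp
        exact (hf x hx).1
    _ ≤ _ := by gcongr

/-! ### The upper box dimension bounds the critical exponent -/

theorem eventually_packingCount_le {F : Set (E n)} {t : ℝ≥0} (ht : upperBoxDim F < t) :
    ∀ᶠ r : ℝ in 𝓝[>] 0,
      (packingCount F r : ℝ≥0∞) ≤ ENNReal.ofReal (r ^ (-(t : ℝ))) := by
  filter_upwards [eventually_lt_of_limsup_lt ht, Ioo_mem_nhdsGT one_pos] with r hr hr1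
  have hlog : 0 < -Real.log r := neg_pos.2 (Real.log_neg hr1.1 hr1.2)
  have h1 : ENNReal.log (packingCount F r : ℝ≥0∞) / ((-Real.log r : ℝ) : EReal) ≤
      ((t : ℝ≥0∞) : EReal) :=
    ((le_max_right _ _).trans EReal.coe_toENNReal_eq_max.ge).trans (EReal.coe_ennreal_le_coe_ennreal_iff.2 hr.le)
  rw [EReal.div_le_iff_le_mul (by exact_mod_cast hlog) (EReal.coe_ne_top _)] at h1
  rw [← ENNReal.log_le_log_iff, ENNReal.log_ofReal_of_pos (Real.rpow_pos_of_pos hr1.1 _),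
    Real.log_rpow hr1.1]
  refine h1.trans (le_of_eq ?_)
  have : ((t : ℝ≥0∞) : EReal) = ((t : ℝ) : EReal) := rfl
  rw [this, ← EReal.coe_mul]
  congr 1
  ring

theorem subset_iUnion_shell {X : Set (E n)} (hX : ∀ x ∈ X, ‖x‖ < 1) :
    X ⊆ ⋃ k : ℕ, shell X ((1 / 2) ^ k) := by
  intro x hx
  have h1 := hX x hx
  have h0 := norm_nonneg x
  obtain ⟨k, hk1, hk2⟩ := exists_nat_pow_near_of_lt_one (x := 1 - ‖x‖) (y := (1 / 2 : ℝ))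
    (by linarith) (by linarith) (by norm_num) (by norm_num)
  refine mem_iUnion.2 ⟨k, hx, ?_, hk2⟩
  rw [pow_succ] at hk1
  linarith

theorem tsum_shell_le (X : Set (E n)) {r : ℝ} (hr : 0 < r) (s : ℝ≥0) :
    ∑' x : shell X r, ENNReal.ofReal ((1 - ‖(x : E n)‖) ^ (s : ℝ)) ≤
      ((shell X r).encard : ℝ≥0∞) * ENNReal.ofReal (r ^ (s : ℝ)) := by
  calc _ ≤ ∑' _ : shell X r, ENNReal.ofReal (r ^ (s : ℝ)) := by
        refine ENNReal.tsum_le_tsum fun x => ENNReal.ofReal_le_ofReal ?_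
        have := x.2.2.1
        exact Real.rpow_le_rpow (by linarith) x.2.2.2 s.2
    _ = _ := by rw [ENNReal.tsum_const]; rfl

theorem IsKleinian.accumulationSeries_lt_top {Γ : Subgroup (Equiv.Perm (Ball n))}
    (hΓ : IsKleinian Γ) (hne : (limitSet (orbit Γ)).Nontrivial) {t s : ℝ≥0}
    (ht : upperBoxDim (limitSet (orbit Γ)) < t) (hts : t < s) :
    accumulationSeries (orbit Γ) s < ∞ := by
  obtain ⟨K, hK⟩ := hΓ.exists_encard_shell_le hne
  have hr : ∀ k : ℕ, (0 : ℝ) < (1 / 2) ^ k := fun k => by positivity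
  have hlim : Tendsto (fun k : ℕ => ((1 / 2 : ℝ)) ^ k) atTop (𝓝[>] 0) :=
    tendsto_nhdsWithin_iff.2 ⟨tendsto_pow_atTop_nhds_zero_of_lt_one (by norm_num) (by norm_num),
      Eventually.of_forall hr⟩
  obtain ⟨N, hN⟩ := eventually_atTop.1 (hlim.eventually (eventually_packingCount_le ht))
  set a : ℕ → ℝ≥0∞ := fun k =>
    ∑' x : shell (orbit Γ) ((1 / 2) ^ k), ENNReal.ofReal ((1 - ‖(x : E n)‖) ^ (s : ℝ)) with ha
  have hfin : ∀ k, a k < ∞ := fun k => by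
    refine (tsum_shell_le _ (hr k) s).trans_lt (ENNReal.mul_lt_top ?_ ENNReal.ofReal_lt_top)
    rw [(hΓ.finite_shell (hr k)).encard_eq_coe_toFinset_card]
    simp
  have hgeo : ∀ k, N ≤ k → a k ≤ K * ENNReal.ofReal ((1 / 2) ^ ((s : ℝ) - t)) ^ k := fun k hk => by
    calc a k ≤ ((shell (orbit Γ) ((1 / 2) ^ k)).encard : ℝ≥0∞) *
          ENNReal.ofReal (((1 / 2) ^ k) ^ (s : ℝ)) := tsum_shell_le _ (hr k) s
      _ ≤ (K * ENNReal.ofReal (((1 / 2) ^ k) ^ (-(t : ℝ)))) *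
          ENNReal.ofReal (((1 / 2) ^ k) ^ (s : ℝ)) := by
          gcongr
          refine le_trans ?_ (mul_le_mul_right (hN k hk) _)
          exact_mod_cast ENat.toENNReal_mono (hK _ (hr k))
      _ = _ := by
          rw [mul_assoc, ← ENNReal.ofReal_mul (by positivity), ← Real.rpow_add (hr k),
            ← ENNReal.ofReal_pow (by positivity), ← Real.rpow_natCast, ← Real.rpow_natCast,
            ← Real.rpow_mul (by norm_num), ← Real.rpow_mul (by norm_num)]
          ring_nf
  have hq : ENNReal.ofReal ((1 / 2) ^ ((s : ℝ) - t)) < 1 := by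
    rw [ENNReal.ofReal_lt_one]
    exact Real.rpow_lt_one (by norm_num) (by norm_num) (sub_pos.2 (by exact_mod_cast hts))
  calc accumulationSeries (orbit Γ) s
      ≤ ∑' x : ⋃ k : ℕ, shell (orbit Γ) ((1 / 2) ^ k),
          ENNReal.ofReal ((1 - ‖(x : E n)‖) ^ (s : ℝ)) :=
        ENNReal.tsum_mono_subtype (fun x : E n => ENNReal.ofReal ((1 - ‖x‖) ^ (s : ℝ)))
          (subset_iUnion_shell fun x hx => norm_lt_one_of_mem_orbit hx)
    _ ≤ ∑' k, a k := ENNReal.tsum_iUnion_le_tsum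
          (fun x : E n => ENNReal.ofReal ((1 - ‖x‖) ^ (s : ℝ))) _
    _ = ∑ k ∈ Finset.range N, a k + ∑' k, a (k + N) :=
        (ENNReal.summable.sum_add_tsum_nat_add').symm
    _ < ∞ := by
        refine ENNReal.add_lt_top.2 ⟨ENNReal.sum_lt_top.2 fun k _ => hfin k, ?_⟩
        refine (ENNReal.tsum_le_tsum fun k => hgeo (k + N) (Nat.le_add_left _ _)).trans_lt ?_
        rw [ENNReal.tsum_mul_left]
        refine ENNReal.mul_lt_top (ENNReal.natCast_lt_top K) ?_
        simp_rw [pow_add]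
        rw [ENNReal.tsum_mul_right]
        exact ENNReal.mul_lt_top (tsum_geometric_lt_top.2 hq)
          (ENNReal.pow_lt_top (hq.trans ENNReal.one_lt_top))

theorem IsKleinian.criticalExponent_le_upperBoxDim {Γ : Subgroup (Equiv.Perm (Ball n))}
    (hΓ : IsKleinian Γ) (hne : (limitSet (orbit Γ)).Nontrivial) :
    criticalExponent (orbit Γ) ≤ upperBoxDim (limitSet (orbit Γ)) := by
  refine le_of_forall_gt_imp_ge_of_dense fun b hb => ?_
  obtain ⟨s, hs, hsb⟩ := ENNReal.lt_iff_exists_nnreal_btwn.1 hb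
  obtain ⟨t, ht, hts⟩ := ENNReal.lt_iff_exists_nnreal_btwn.1 hs
  exact (iInf₂_le s (hΓ.accumulationSeries_lt_top hne ht (by exact_mod_cast hts))).trans hsb.le

/-! ### The radial limit set -/

theorem dimH_radialLimitSet_le {X : Set (E n)} (hX : ∀ x ∈ X, ‖x‖ < 1) {s : ℝ≥0}
    (hs : accumulationSeries X s < ∞) : dimH (radialLimitSet X) ≤ s := by
  have hpos : ∀ x ∈ X, 0 < 1 - ‖x‖ := fun x hx => sub_pos.2 (hX x hx)
  have : Countable X := by
    refine countable_univ_iff.1 ((Summable.countable_support_ennreal hs.ne).mono fun x _ => ?_)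
    exact (ENNReal.ofReal_pos.2 (Real.rpow_pos_of_pos (hpos x x.2) _)).ne'
  borelize (E n)
  have hsub : radialLimitSet X ⊆ ⋃ m : ℕ, {z : E n | ∀ r : ℝ, 0 < r →
      ∃ x ∈ X, ‖z - x‖ ≤ m * (1 - ‖x‖) ∧ 1 - ‖x‖ ≤ r} := by
    rintro z ⟨-, c, hc, hz⟩
    obtain ⟨m, hm⟩ := exists_nat_ge c
    refine mem_iUnion.2 ⟨m, fun r hr => ?_⟩
    obtain ⟨x, hx, h1, h2⟩ := hz r hr
    exact ⟨x, hx, h1.trans (mul_le_mul_of_nonneg_right hm (hpos x hx).le),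
      le_of_mul_le_mul_left h2 (by linarith)⟩
  refine (dimH_mono hsub).trans ?_
  rw [dimH_iUnion]
  refine iSup_le fun m => dimH_le_of_hausdorffMeasure_ne_top (ne_of_lt ?_)
  -- The balls about orbit points at distance at most `1 / (k + 1)` from the sphere cover.
  let U : ℕ → X → Set (E n) := fun k x =>
    {z | ‖z - x‖ ≤ m * (1 - ‖(x : E n)‖) ∧ 1 - ‖(x : E n)‖ ≤ 1 / ((k : ℝ) + 1)}
  have hU : ∀ k x, Metric.ediam (U k x) ≤ ENNReal.ofReal (2 * m * (1 - ‖(x : E n)‖)) := by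
    intro k x
    refine Metric.ediam_le fun y hy z hz => ?_
    rw [edist_dist]
    refine ENNReal.ofReal_le_ofReal ?_
    have h1 := hy.1
    have h2 := hz.1
    have := dist_triangle_right y z (x : E n)
    rw [dist_eq_norm y x, dist_eq_norm z x] at this
    linarith
  refine (MeasureTheory.Measure.hausdorffMeasure_le_liminf_tsum (l := atTop) s _
    (fun k : ℕ => ENNReal.ofReal (2 * m * (1 / ((k : ℝ) + 1)))) ?_ U ?_ ?_).trans_lt ?_
  · have := (tendsto_one_div_add_atTop_nhds_zero_nat (𝕜 := ℝ)).const_mul (2 * (m : ℝ))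
    simpa using ENNReal.tendsto_ofReal this
  · refine Eventually.of_forall fun k x => ?_
    by_cases h : 1 - ‖(x : E n)‖ ≤ 1 / ((k : ℝ) + 1)
    · exact (hU k x).trans (ENNReal.ofReal_le_ofReal (by gcongr))
    · have : U k x = ∅ := eq_empty_of_forall_notMem fun z hz => h hz.2
      simp [this]
  · refine Eventually.of_forall fun k z hz => ?_
    obtain ⟨x, hx, h1, h2⟩ := hz (1 / ((k : ℝ) + 1)) (by positivity)
    exact mem_iUnion.2 ⟨⟨x, hx⟩, h1, h2⟩
  · have hb : ∀ k, ∑' x, Metric.ediam (U k x) ^ (s : ℝ) ≤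
        ENNReal.ofReal ((2 * m) ^ (s : ℝ)) * accumulationSeries X s := fun k => by
      rw [accumulationSeries, ← ENNReal.tsum_mul_left]
      refine ENNReal.tsum_le_tsum fun x => ?_
      have := hpos x x.2
      rw [← ENNReal.ofReal_mul (by positivity), ← Real.mul_rpow (by positivity) this.le,
        ← ENNReal.ofReal_rpow_of_nonneg (by positivity) s.coe_nonneg]
      exact ENNReal.rpow_le_rpow (hU k x) s.2
    calc liminf (fun k => ∑' x, Metric.ediam (U k x) ^ (s : ℝ)) atTop
        ≤ liminf (fun _ : ℕ => ENNReal.ofReal ((2 * m) ^ (s : ℝ)) * accumulationSeries X s)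
          atTop := liminf_le_liminf (Eventually.of_forall hb)
      _ = _ := liminf_const _
      _ < ∞ := ENNReal.mul_lt_top ENNReal.ofReal_lt_top hs

/-! ### The two series -/

theorem exp_neg_mul_hdist_origin (s : ℝ≥0) (x : Ball n) :
    Real.exp (-((s : ℝ) * hdist (origin n) x)) =
      ((1 - ‖(x : E n)‖) / (1 + ‖(x : E n)‖)) ^ (s : ℝ) := by
  rw [← exp_neg_hdist_origin, ← Real.exp_mul]
  ring_nf

theorem accumulationSeries_le_mul_poincareSeries (Γ : Subgroup (Equiv.Perm (Ball n))) (s : ℝ≥0) :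
    accumulationSeries (orbit Γ) s ≤ ENNReal.ofReal (2 ^ (s : ℝ)) * poincareSeries Γ s := by
  have h : ∀ x : orbit Γ, ∃ g : Γ, ((g : Equiv.Perm (Ball n)) (origin n) : E n) = x := by
    rintro ⟨_, g, hg, rfl⟩
    exact ⟨⟨g, hg⟩, rfl⟩
  choose γ hγ using h
  have hinj : Function.Injective γ := fun x y hxy => Subtype.ext (by rw [← hγ x, ← hγ y, hxy])
  calc accumulationSeries (orbit Γ) s
      ≤ ∑' x : orbit Γ, ENNReal.ofReal (2 ^ (s : ℝ)) * ENNReal.ofReal (Real.exp (-((s : ℝ) *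
          hdist (origin n) ((γ x : Equiv.Perm (Ball n)) (origin n))))) := by
        refine ENNReal.tsum_le_tsum fun x => ?_
        have h1 := norm_lt_one ((γ x : Equiv.Perm (Ball n)) (origin n))
        rw [exp_neg_mul_hdist_origin, ← ENNReal.ofReal_mul (by positivity), ← hγ x]
        have h0 := norm_nonneg ((γ x : Equiv.Perm (Ball n)) (origin n) : E n)
        generalize ‖((γ x : Equiv.Perm (Ball n)) (origin n) : E n)‖ = t at *
        have h2 : 0 ≤ 1 - t := by linarith
        rw [← Real.mul_rpow (by norm_num) (by positivity)]
        refine ENNReal.ofReal_le_ofReal (Real.rpow_le_rpow h2 ?_ s.2)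
        rw [mul_div_assoc', le_div_iff₀ (by linarith)]
        nlinarith
    _ ≤ _ := by
        rw [ENNReal.tsum_mul_left]
        gcongr
        exact ENNReal.tsum_comp_le_tsum_of_injective hinj (fun g : Γ => ENNReal.ofReal
          (Real.exp (-((s : ℝ) * hdist (origin n) ((g : Equiv.Perm (Ball n)) (origin n))))))

/-- Each orbit point is attained by as many group elements as there are in the stabiliser of the
centre, which is finite. -/
theorem IsKleinian.poincareSeries_le_mul_accumulationSeries
    {Γ : Subgroup (Equiv.Perm (Ball n))} (hΓ : IsKleinian Γ) :
    ∃ N : ℕ, ∀ s : ℝ≥0, poincareSeries Γ s ≤ N * accumulationSeries (orbit Γ) s := by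
  have hfin := hΓ.finite_setOf_norm_le zero_lt_one
  set T := {g | g ∈ Γ ∧ ‖(g (origin n) : E n)‖ ≤ 0} with hT
  have : Fintype T := hfin.fintype
  refine ⟨Fintype.card T, fun s => ?_⟩
  have h : ∀ x : orbit Γ, ∃ g : Γ, ((g : Equiv.Perm (Ball n)) (origin n) : E n) = x := by
    rintro ⟨_, g, hg, rfl⟩
    exact ⟨⟨g, hg⟩, rfl⟩
  choose γ hγ using h
  let pt : Γ → orbit Γ := fun g => ⟨(g : Equiv.Perm (Ball n)) (origin n), g, g.2, rfl⟩
  have hstab : ∀ g : Γ, (((γ (pt g))⁻¹ * g : Γ) : Equiv.Perm (Ball n)) ∈ T := fun g => by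
    refine ⟨((γ (pt g))⁻¹ * g : Γ).2, ?_⟩
    have h1 : (γ (pt g) : Equiv.Perm (Ball n)) (origin n) =
        (g : Equiv.Perm (Ball n)) (origin n) := Subtype.ext (hγ (pt g))
    have h2 : (((γ (pt g))⁻¹ * g : Γ) : Equiv.Perm (Ball n)) (origin n) = origin n := by
      simp [← h1]
    rw [h2]
    simp
  let Φ : Γ → orbit Γ × T := fun g => (pt g, ⟨_, hstab g⟩)
  have hΦ : Function.Injective Φ := fun g h he => by
    have h1 : pt g = pt h := congrArg Prod.fst he
    have h2 : (γ (pt g))⁻¹ * g = (γ (pt h))⁻¹ * h :=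
      Subtype.ext (congrArg (fun p => (p.2 : Equiv.Perm (Ball n))) he)
    rw [h1] at h2
    exact mul_left_cancel h2
  calc poincareSeries Γ s
      ≤ ∑' g : Γ, ENNReal.ofReal ((1 - ‖((Φ g).1 : E n)‖) ^ (s : ℝ)) := by
        refine ENNReal.tsum_le_tsum fun g => ?_
        have h1 := norm_lt_one ((g : Equiv.Perm (Ball n)) (origin n))
        have h0 := norm_nonneg ((g : Equiv.Perm (Ball n)) (origin n) : E n)
        rw [exp_neg_mul_hdist_origin]
        refine ENNReal.ofReal_le_ofReal (Real.rpow_le_rpow (div_nonneg (by linarith) (by linarith))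
          (div_le_self (by linarith) (by linarith)) s.2)
    _ ≤ ∑' p : orbit Γ × T, ENNReal.ofReal ((1 - ‖(p.1 : E n)‖) ^ (s : ℝ)) :=
        ENNReal.tsum_comp_le_tsum_of_injective hΦ
          (fun p : orbit Γ × T => ENNReal.ofReal ((1 - ‖(p.1 : E n)‖) ^ (s : ℝ)))
    _ = _ := by
        rw [ENNReal.tsum_prod (f := fun (x : orbit Γ) (_ : T) =>
          ENNReal.ofReal ((1 - ‖(x : E n)‖) ^ (s : ℝ))), accumulationSeries, ← ENNReal.tsum_mul_left]
        simp

theorem IsKleinian.poincareSeries_lt_top_iff {Γ : Subgroup (Equiv.Perm (Ball n))}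
    (hΓ : IsKleinian Γ) (s : ℝ≥0) :
    poincareSeries Γ s < ∞ ↔ accumulationSeries (orbit Γ) s < ∞ := by
  obtain ⟨N, hN⟩ := hΓ.poincareSeries_le_mul_accumulationSeries
  exact ⟨fun h => (accumulationSeries_le_mul_poincareSeries Γ s).trans_lt
    (ENNReal.mul_lt_top ENNReal.ofReal_lt_top h),
    fun h => (hN s).trans_lt (ENNReal.mul_lt_top (ENNReal.natCast_lt_top N) h)⟩

theorem IsKleinian.criticalExponent_eq_poincareExponent {Γ : Subgroup (Equiv.Perm (Ball n))}
    (hΓ : IsKleinian Γ) : criticalExponent (orbit Γ) = poincareExponent Γ := by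
  simp only [criticalExponent, poincareExponent, hΓ.poincareSeries_lt_top_iff]

end HypBall

theorem mainTheorem7 (n : ℕ) (Γ : Subgroup (Equiv.Perm (HypBall.Ball n)))
    (hΓ : HypBall.IsKleinian Γ) (hne : HypBall.IsNonElementary Γ) :
    HypBall.criticalExponent (HypBall.orbit Γ) = HypBall.poincareExponent Γ ∧
      dimH (HypBall.radialLimitSet (HypBall.orbit Γ)) ≤ HypBall.poincareExponent Γ ∧
      HypBall.poincareExponent Γ ≤ HypBall.upperBoxDim (HypBall.limitSet (HypBall.orbit Γ)) := by
  have hnt : (HypBall.limitSet (HypBall.orbit Γ)).Nontrivial :=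
    Set.one_lt_encard_iff_nontrivial.1 (lt_trans (by norm_num) hne)
  have heq := hΓ.criticalExponent_eq_poincareExponent
  refine ⟨heq, ?_, heq ▸ hΓ.criticalExponent_le_upperBoxDim hnt⟩
  rw [← heq]
  exact le_iInf₂ fun s hs =>
    HypBall.dimH_radialLimitSet_le (fun x hx => HypBall.norm_lt_one_of_mem_orbit hx) hs
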